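/- Let $\mathsf G=(\mathsf V,\mathsf E)$ be a finite connected graph (loops and multiple edges allowed) with a fixed orientation $\mathsf E^+$ of its edges; each $e\in\mathsf E^+$ goes from $\underline e$ to $\overline e$. Let $\mathbb K=\mathbb R$ or $\mathbb C$, and let $\underline x=(x_e)_{e\in \mathsf E^+}$ be positive real weights. Let $\Omega^0=\mathbb K^{\mathsf V}$ have the inner product $\langle f,g\rangle=\sum_{v}\overline{f_v}\,g_v$ and let $\Omega^1=\mathbb K^{\mathsf E^+}$ (the $1$-forms) have the inner product $\langle \alpha,\beta\rangle=\sum_{e\in\mathsf E^+}x_e\,\overline{\alpha_e}\,\beta_e$. Let $d:\Omega^0\to\Omega^1$, $(df)_e=f_{\overline e}-f_{\underline e}$. Adjoints are taken with respect to these inner products. Let $k\ge 0$ and $\theta_1,\dots,\theta_k\in\Omega^1$. Let $\omega_{\underline\theta}:\mathbb K^k\to\Omega^1$, $\alpha\mapsto\alpha_1\theta_1+\dots+\alpha_k\theta_k$, where $\mathbb K^k$ is endowed with $|\mathsf V|$ times the usual inner product. On the orthogonal direct sum $\operatorname{im} d^*\oplus\mathbb K^k$ consider the operator $d\oplus\omega_{\underline\theta}:(f,\alpha)\mapsto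 df+\omega_{\underline\theta}\alpha$ with values in $\Omega^1$, and the endomorphism $\Delta_{\underline\theta}=(d\oplus\omega_{\underline\theta})^*(d\oplus\omega_{\underline\theta})$ of $\operatorname{im} d^*\oplus\mathbb K^k$. For $K\subseteq \mathsf E^+$, let $Z_1(K,\mathbb Z)$ be the group of $c\in\mathbb Z^{\mathsf E^+}$ supported in $K$ such that $\partial c=0$, where $\partial e=\overline e-\underline e$. Let $\mathcal C_k(\mathsf G)$ be the set of those $K$ for which $(\mathsf V,K)$ is connected and $Z_1(K,\mathbb Z)$ has rank $k$. For $K\in\mathcal C_k(\mathsf G)$, let $z_K=\gamma_1\wedge\dots\wedge\gamma_k$ for an integral basis $(\gamma_1,\dots,\gamma_k)$ of $Z_1(K,\mathbb Z)$ (so that $z_K$ is defined up to a sign). For $\vartheta\in\bigwedge^k\Omega^1$, let $(\vartheta,z_K)$ be the duality pairing, so that $(\theta_1\wedge\dots\wedge\theta_k,z_K)=\det(\theta_i(\gamma_j))_{i,j}$ with $\theta(\gamma)=\sum_{e\in\mathsf E^+}\theta_e\gamma_e$. Put $$\mathsf C^{(k)}_{\mathsf G}(\vartheta,\underline x)=\sum_{K\in\mathcal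 C_k(\mathsf G)}|(\vartheta,z_K)|^2\prod_{e\in K}x_e .$$ Then, for $\vartheta=\theta_1\wedge\dots\wedge\theta_k$, $$\mathsf C^{(k)}_{\mathsf G}(\vartheta,\underline x)=|\mathsf V|^{k-1}\det\Delta_{\underline\theta}.$$ -/

import Mathlib

/-- Families of positive real weights indexed by `ι`. -/
abbrev PosWeight (ι : Type*) : Type _ := {w : ι → ℝ // ∀ i, 0 < w i}

/-- The space `𝕜^ι`, to be equipped with the inner product `⟪a, b⟫ = ∑ i, w i * conj (a i) * b i`. -/
def WeightedSpace (𝕜 : Type*) {ι : Type*} (_w : PosWeight ι) : Type _ := ι → 𝕜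

namespace WeightedSpace

variable {𝕜 : Type*} [RCLike 𝕜] {ι : Type*} (w : PosWeight ι)

instance : AddCommGroup (WeightedSpace 𝕜 w) := inferInstanceAs (AddCommGroup (ι → 𝕜))

instance : Module 𝕜 (WeightedSpace 𝕜 w) := inferInstanceAs (Module 𝕜 (ι → 𝕜))

/-- The identification of `𝕜^ι` with `𝕜^ι` endowed with the weighted inner product. -/
def of : (ι → 𝕜) ≃ₗ[𝕜] WeightedSpace 𝕜 w := LinearEquiv.refl 𝕜 (ι → 𝕜)

variable [Fintype ι]

/-- The weighted inner product `⟪a, b⟫ = ∑ i, w i * conj (a i) * b i`. -/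
abbrev core : InnerProductSpace.Core 𝕜 (WeightedSpace 𝕜 w) where
  inner a b := ∑ i, ((w.1 i : ℝ) : 𝕜) * (starRingEnd 𝕜 ((of w).symm a i) * (of w).symm b i)
  conj_inner_symm a b := by
    simp only [map_sum, map_mul, RCLike.conj_ofReal, RCLike.conj_conj]
    exact Finset.sum_congr rfl fun i _ => by ring
  re_inner_nonneg a := by
    rw [map_sum]
    refine Finset.sum_nonneg fun i _ => ?_
    rw [RCLike.re_ofReal_mul, RCLike.conj_mul]
    norm_cast
    exact mul_nonneg (w.2 i).le (sq_nonneg _)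
  add_left a b c := by
    rw [← Finset.sum_add_distrib]
    refine Finset.sum_congr rfl fun i _ => ?_
    rw [map_add, Pi.add_apply, map_add]
    ring
  smul_left a b r := by
    rw [Finset.mul_sum]
    refine Finset.sum_congr rfl fun i _ => ?_
    rw [map_smul, Pi.smul_apply, smul_eq_mul, map_mul]
    ring
  definite a h := by
    have h2 : ∑ i, w.1 i * ‖(of w).symm a i‖ ^ 2 = 0 := by
      have h3 : ((∑ i, w.1 i * ‖(of w).symm a i‖ ^ 2 : ℝ) : 𝕜) = 0 := by
        rw [← h]
        push_cast
        exact Finset.sum_congr rfl fun i _ => by rw [RCLike.conj_mul]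
      exact_mod_cast h3
    rw [Finset.sum_eq_zero_iff_of_nonneg
      (fun i _ => mul_nonneg (w.2 i).le (sq_nonneg _))] at h2
    apply (of w).symm.injective
    rw [map_zero]
    funext i
    have h4 := h2 i (Finset.mem_univ i)
    simpa [(w.2 i).ne'] using h4

noncomputable instance : NormedAddCommGroup (WeightedSpace 𝕜 w) :=
  (core w).toNormedAddCommGroup

noncomputable instance : InnerProductSpace 𝕜 (WeightedSpace 𝕜 w) :=
  InnerProductSpace.ofCore (core w).toCore

theorem inner_def (a b : WeightedSpace 𝕜 w) :
    inner 𝕜 a b =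
      ∑ i, ((w.1 i : ℝ) : 𝕜) * (starRingEnd 𝕜 ((of w).symm a i) * (of w).symm b i) := rfl

instance : FiniteDimensional 𝕜 (WeightedSpace 𝕜 w) :=
  Module.Finite.equiv (of (𝕜 := 𝕜) w)

end WeightedSpace

/-- A multigraph (loops and multiple edges allowed) with vertex set `V` and with a fixed
orientation: `E` is the set of positively oriented edges, and the edge `e` goes from `src e` to
`tgt e`. A set of geometric edges is thus a subset of `E`, and an antisymmetric function on
oriented edges is given by its values on `E`. -/
structure OrientedGraph (V E : Type*) where
  /-- starting vertex -/
  src : E → V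
  /-- ending vertex -/
  tgt : E → V

namespace OrientedGraph

variable {V E : Type*} (G : OrientedGraph V E)

/-- The spanning subgraph with vertex set `V` and edge set `K` is connected. -/
def SpanningConnected (K : Finset E) : Prop :=
  (SimpleGraph.fromRel fun v w : V => ∃ e ∈ K, G.src e = v ∧ G.tgt e = w).Connected

/-- The boundary operator `∂ : C₁(G, ℤ) → C₀(G, ℤ)`, `∂ e = tgt e - src e`, where
`C₁(G, ℤ) = ℤ^E` and `C₀(G, ℤ) = ℤ^V`. -/
def boundary [DecidableEq V] [Fintype E] : (E → ℤ) →ₗ[ℤ] (V → ℤ) :=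
  ∑ e : E, (LinearMap.proj e).smulRight (Pi.single (G.tgt e) 1 - Pi.single (G.src e) 1)

/-- `Z₁(K, ℤ)`: the integral cycles of `G` that are supported by the set of edges `K`. -/
def cycles [DecidableEq V] [Fintype E] (K : Finset E) : Submodule ℤ (E → ℤ) where
  carrier := {c | G.boundary c = 0 ∧ ∀ e ∉ K, c e = 0}
  add_mem' := by
    rintro a b ⟨ha, ha'⟩ ⟨hb, hb'⟩
    exact ⟨by rw [map_add, ha, hb, add_zero],
      fun e he => by rw [Pi.add_apply, ha' e he, hb' e he, add_zero]⟩
  zero_mem' := ⟨map_zero _, fun _ _ => rfl⟩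
  smul_mem' := by
    rintro r a ⟨ha, ha'⟩
    exact ⟨by rw [map_smul, ha, smul_zero], fun e he => by rw [Pi.smul_apply, ha' e he, smul_zero]⟩

/-- The set `𝒞ₖ(G)` of connected spanning subgraphs with first Betti number `k`. -/
noncomputable def connectedSubgraphs [DecidableEq V] [Fintype E] (k : ℕ) : Finset (Finset E) :=
  open scoped Classical in
  Finset.univ.filter fun K => G.SpanningConnected K ∧ Module.finrank ℤ (G.cycles K) = k

/-- The exterior product `γ₁ ∧ … ∧ γₖ` of integral `1`-chains, in the `k`-th exterior power of
`C₁(G, ℤ) ⊗ 𝕜 = 𝕜^E`. -/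
noncomputable def wedgeChains (𝕜 : Type*) [RCLike 𝕜] {k : ℕ} (γ : Fin k → E → ℤ) :
    ⋀[𝕜]^k (E → 𝕜) :=
  exteriorPower.ιMulti 𝕜 k fun i e => ((γ i e : ℤ) : 𝕜)

/-- The duality pairing `(ϑ, z)` between `k`-th exterior powers of the space `𝕜^E` of `1`-forms
and of the space `𝕜^E` of `1`-chains, induced by `(θ, γ) = ∑ e, θ e * γ e`; explicitly
`(θ₁ ∧ … ∧ θₖ, γ₁ ∧ … ∧ γₖ) = det (θᵢ, γⱼ)`. -/
noncomputable def extPairing {𝕜 : Type*} [RCLike 𝕜] [Fintype E] {k : ℕ}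
    (ϑ z : ⋀[𝕜]^k (E → 𝕜)) : 𝕜 :=
  exteriorPower.pairingDual 𝕜 (E → 𝕜) k
    (exteriorPower.map k (dotProductBilin 𝕜 𝕜 : (E → 𝕜) →ₗ[𝕜] (E → 𝕜) →ₗ[𝕜] 𝕜) ϑ) z

/-- `z_K`, the exterior product of the elements of an integral basis of `Z₁(K, ℤ)`. It is defined
up to a sign, and the basis is chosen arbitrarily (see `norm_extPairing_cycleWedge`). -/
noncomputable def cycleWedge (𝕜 : Type*) [RCLike 𝕜] [DecidableEq V] [Fintype E] {k : ℕ}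
    {K : Finset E} (h : Module.finrank ℤ (G.cycles K) = k) : ⋀[𝕜]^k (E → 𝕜) :=
  wedgeChains 𝕜 fun i => (Module.finBasisOfFinrankEq ℤ (G.cycles K) h i : E → ℤ)

theorem mem_connectedSubgraphs [DecidableEq V] [Fintype E] {k : ℕ} {K : Finset E} :
    K ∈ G.connectedSubgraphs k ↔
      G.SpanningConnected K ∧ Module.finrank ℤ (G.cycles K) = k := by
  simp [connectedSubgraphs]

theorem extPairing_ιMulti_wedgeChains {𝕜 : Type*} [RCLike 𝕜] [Fintype E] {k : ℕ}
    (θ : Fin k → E → 𝕜) (γ : Fin k → E → ℤ) :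
    extPairing (exteriorPower.ιMulti 𝕜 k θ) (wedgeChains 𝕜 γ) =
      Matrix.det (Matrix.of fun i j => ∑ e, θ i e * ((γ j e : ℤ) : 𝕜)) := by
  rw [extPairing, wedgeChains, exteriorPower.map_apply_ιMulti,
    exteriorPower.pairingDual_ιMulti_ιMulti, ← Matrix.det_transpose]
  rfl

/-- Changing the integral basis multiplies the exterior product of its elements by `±1`. -/
theorem cycleWedge_eq_or_neg (𝕜 : Type*) [RCLike 𝕜] [DecidableEq V] [Fintype E] {k : ℕ}
    {K : Finset E} (h : Module.finrank ℤ (G.cycles K) = k)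
    (b : Module.Basis (Fin k) ℤ (G.cycles K)) :
    G.cycleWedge 𝕜 h = wedgeChains 𝕜 (fun i => (b i : E → ℤ)) ∨
      G.cycleWedge 𝕜 h = -wedgeChains 𝕜 (fun i => (b i : E → ℤ)) := by
  let c : (G.cycles K) →ₗ[ℤ] (E → 𝕜) :=
    { toFun := fun γ e => (((γ : E → ℤ) e : ℤ) : 𝕜)
      map_add' := fun x y => by funext e; simp
      map_smul' := fun r x => by funext e; simp }
  have hc (v : Fin k → G.cycles K) (i : Fin k) (x : G.cycles K) :
      (fun j => c (Function.update v i x j)) = Function.update (fun j => c (v j)) i (c x) := by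
    funext j
    exact Function.apply_update (fun _ => c) v i x j
  let f : (G.cycles K) [⋀^Fin k]→ₗ[ℤ] (⋀[𝕜]^k (E → 𝕜)) :=
    { toFun := fun v => exteriorPower.ιMulti 𝕜 k fun i => c (v i)
      map_update_add' := fun {inst} v i x y => by
        rw [Subsingleton.elim inst (instDecidableEqFin k)]
        simp only [hc, map_add, AlternatingMap.map_update_add]
      map_update_smul' := fun {inst} v i r x => by
        rw [Subsingleton.elim inst (instDecidableEqFin k)]
        simp only [hc, map_smul]
        rw [← Int.cast_smul_eq_zsmul 𝕜 r (c x), AlternatingMap.map_update_smul,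
          Int.cast_smul_eq_zsmul]
      map_eq_zero_of_eq' := fun v i j hij hne =>
        (exteriorPower.ιMulti 𝕜 k).map_eq_zero_of_eq _ (by rw [hij]) hne }
  let b' := Module.finBasisOfFinrankEq ℤ (G.cycles K) h
  have key : f b' = b.det b' • f b := by
    have h0 : f = (LinearMap.toSpanSingleton ℤ _ (f b)).compAlternatingMap b.det := by
      refine Module.Basis.ext_alternating b fun v hv => ?_
      let σ : Equiv.Perm (Fin k) := Equiv.ofBijective v (Finite.injective_iff_bijective.1 hv)
      change f (b ∘ σ) = b.det (b ∘ σ) • f b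
      simp [AlternatingMap.map_perm, Module.Basis.det_self]
    conv_lhs => rw [h0]
    rfl
  have hu : IsUnit (b.det b') := b.isUnit_det b'
  have h1 : G.cycleWedge 𝕜 h = f b' := rfl
  have h2 : wedgeChains 𝕜 (fun i => (b i : E → ℤ)) = f b := rfl
  rw [h1, h2, key]
  rcases Int.isUnit_iff.1 hu with h3 | h3
  · left; rw [h3, one_smul]
  · right; rw [h3, neg_smul, one_smul]

/-- The weight `|(ϑ, z_K)|` does not depend on the integral basis of `Z₁(K, ℤ)`. -/
theorem norm_extPairing_cycleWedge {𝕜 : Type*} [RCLike 𝕜] [DecidableEq V] [Fintype E] {k : ℕ}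
    {K : Finset E} (h : Module.finrank ℤ (G.cycles K) = k)
    (b : Module.Basis (Fin k) ℤ (G.cycles K)) (ϑ : ⋀[𝕜]^k (E → 𝕜)) :
    ‖extPairing ϑ (G.cycleWedge 𝕜 h)‖ =
      ‖extPairing ϑ (wedgeChains 𝕜 fun i => (b i : E → ℤ))‖ := by
  rcases G.cycleWedge_eq_or_neg 𝕜 h b with h1 | h1
  · rw [h1]
  · rw [h1, extPairing, map_neg, norm_neg, extPairing]

/-- The polynomial `C⁽ᵏ⁾_G(ϑ, x) = ∑ |(ϑ, z_K)|² x^K` in the variables `(x_e)_{e ∈ E}`, where `K`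
runs over the connected spanning subgraphs with first Betti number `k`. -/
noncomputable def connectedPolynomial {𝕜 : Type*} [RCLike 𝕜] [DecidableEq V] [Fintype E] {k : ℕ}
    (ϑ : ⋀[𝕜]^k (E → 𝕜)) : MvPolynomial E ℝ :=
  ∑ K ∈ (G.connectedSubgraphs k).attach,
    MvPolynomial.C
        (‖extPairing ϑ (G.cycleWedge 𝕜 (G.mem_connectedSubgraphs.1 K.2).2)‖ ^ 2) *
      ∏ e ∈ K.1, MvPolynomial.X e

section Laplacian

variable (𝕜 : Type*) [RCLike 𝕜] [Fintype V] [Fintype E] (x : PosWeight E)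

/-- The discrete differential `d : Ω⁰(G) → Ω¹(G)`, `(d f)(e) = f (tgt e) - f (src e)`, where
`Ω⁰(G) = 𝕜^V` has its usual inner product and `Ω¹(G) = 𝕜^E` has the inner product weighted
by `x`. -/
noncomputable def differential : EuclideanSpace 𝕜 V →ₗ[𝕜] WeightedSpace 𝕜 x where
  toFun f := WeightedSpace.of x fun e => f (G.tgt e) - f (G.src e)
  map_add' f g := by
    rw [← map_add]
    congr 1
    funext e
    simp only [PiLp.add_apply, Pi.add_apply]
    ring
  map_smul' r f := by
    rw [RingHom.id_apply, ← map_smul]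
    congr 1
    funext e
    simp only [PiLp.smul_apply, Pi.smul_apply, smul_eq_mul]
    ring

/-- The constant weight `|V|` on `Fin k`. -/
def cardWeight (V : Type*) [Fintype V] [Nonempty V] (k : ℕ) : PosWeight (Fin k) :=
  ⟨fun _ => Fintype.card V, fun _ => Nat.cast_pos.2 Fintype.card_pos⟩

variable {𝕜} [Nonempty V] {k : ℕ}

/-- The map `ω_θ : 𝕜^k → Ω¹(G)`, `(α₁, …, αₖ) ↦ α₁ θ₁ + … + αₖ θₖ`, where `𝕜^k` is endowed with
`|V|` times its usual inner product. -/
noncomputable def omega (θ : Fin k → E → 𝕜) :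
    WeightedSpace 𝕜 (cardWeight V k) →ₗ[𝕜] WeightedSpace 𝕜 x :=
  (WeightedSpace.of x).toLinearMap ∘ₗ Fintype.linearCombination 𝕜 θ ∘ₗ
    (WeightedSpace.of (cardWeight V k)).symm.toLinearMap

/-- The operator `d ⊕ ω_θ : im d^* ⊕ 𝕜^k → Ω¹(G)`, `(f, α) ↦ d f + ω_θ α`, on the orthogonal direct
sum of `im d^*` and `𝕜^k`. -/
noncomputable def augmentedDifferential (θ : Fin k → E → 𝕜) :
    WithLp 2 ((G.differential 𝕜 x).adjoint.range × WeightedSpace 𝕜 (cardWeight V k)) →ₗ[𝕜]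
      WeightedSpace 𝕜 x :=
  ((G.differential 𝕜 x).domRestrict (G.differential 𝕜 x).adjoint.range).coprod
      (omega (V := V) x θ) ∘ₗ
    (WithLp.linearEquiv 2 𝕜 _).toLinearMap

/-- The augmented Laplacian `Δ_θ = (d ⊕ ω_θ)^* (d ⊕ ω_θ)`, an endomorphism of `im d^* ⊕ 𝕜^k`. -/
noncomputable def augmentedLaplacian (θ : Fin k → E → 𝕜) :
    Module.End 𝕜
      (WithLp 2 ((G.differential 𝕜 x).adjoint.range × WeightedSpace 𝕜 (cardWeight V k))) :=
  (G.augmentedDifferential x θ).adjoint ∘ₗ G.augmentedDifferential x θ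

end Laplacian

end OrientedGraph

/-! Take as basis of `im d^*` the orthogonal projections of the indicators of the vertices other
than a fixed `v₀`, together with the standard basis of `𝕜^k`. Its Gram determinant is `|V|⁻¹ *
|V|^k`, the power in the theorem, so multiplying by `det Δ_θ` gives the Gram determinant of the
images under `d ⊕ ω_θ`. Since `d` kills constants, the projections have the same images as the
indicators; the product is `det (Mᴴ X M)`, with `M` the differential matrix and `X` the diagonal of
weights (`det_augmentedLaplacian`).

Cauchy–Binet expands this as a sum of `|det M_K|² x^K` over edge sets `K` with `|V| - 1 + k`
elements. If `K` is not connected, a nonzero function vanishing at `v₀` and constant along the edges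
of `K` lies in the kernel of `M_K`. If `K` is connected, it has Betti number `k`, and an integral
basis of its cycles, completed by paths from `v₀`, is a basis of `ℤ^K`. In that basis `M_K` becomes
block triangular with diagonal blocks `1` and `(θᵢ(γⱼ))`, and the change of basis has determinant
`±1` (`norm_det_differentialMatrix`). -/

/-- The **Cauchy–Binet formula**, where `D K` is the product of the minors of `A` and `B` given by
the set `K` of indices (which does not depend on the enumeration `e` of `K`). -/
theorem Matrix.det_mul_eq_sum_of_forall_injective {R ι E : Type*} [CommRing R] [Fintype ι]
    [DecidableEq ι] [Fintype E] (A : Matrix ι E R) (B : Matrix E ι R) (D : Finset E → R)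
    (hD : ∀ (K : Finset E) (e : ι → E), Function.Injective e → Set.range e = K →
      (A.submatrix id e).det * (B.submatrix e id).det = D K) :
    (A * B).det = ∑ K ∈ Finset.univ.powersetCard (Fintype.card ι), D K := by
  classical
  have h1 : (A * B).det = ∑ f : ι → E, (∏ i, A i (f i)) * (B.submatrix f id).det := by
    have h2 : (A * B) = fun i => ∑ j, A i j • B j := by
      ext i j
      simp [Matrix.mul_apply, Finset.sum_apply]
    rw [h2]
    have h3 := (Matrix.detRowAlternating (n := ι) (R := R)).toMultilinearMap.map_sum
      (fun i j => A i j • B j)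
    refine h3.trans (Finset.sum_congr rfl fun f _ => ?_)
    exact (Matrix.detRowAlternating (n := ι) (R := R)).toMultilinearMap.map_smul_univ
      (fun i => A i (f i)) (fun i => B (f i))
  have h4 : (A * B).det = ∑ f : ι → E with Function.Injective f,
      (∏ i, A i (f i)) * (B.submatrix f id).det := by
    rw [h1]
    refine (Finset.sum_subset (Finset.filter_subset _ _) fun f _ hf => ?_).symm
    have hf' : ¬ Function.Injective f := by simpa using hf
    rw [Function.not_injective_iff] at hf'
    obtain ⟨i, j, hij, hne⟩ := hf'
    rw [Matrix.det_zero_of_row_eq hne (by ext l; simp [hij]), mul_zero]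
  -- Injective maps are grouped by their image `K`; those with image `K` are the `e ∘ σ` for one
  -- enumeration `e` and `σ` a permutation.
  rw [h4, ← Finset.sum_fiberwise_of_maps_to (t := Finset.univ.powersetCard (Fintype.card ι))
    (g := fun f => Finset.univ.image f)]
  swap
  · intro f hf
    rw [Finset.mem_powersetCard_univ,
      Finset.card_image_of_injective _ (by simpa using hf), Finset.card_univ]
  refine Finset.sum_congr rfl fun K hK => ?_
  have hK' := Finset.mem_powersetCard_univ.1 hK
  have ε : ι ≃ K := Fintype.equivOfCardEq (by rw [Fintype.card_coe, hK'])
  let e : ι → E := fun i => ε i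
  have hinj : Function.Injective e := Subtype.val_injective.comp ε.injective
  have hrange : Set.range e = K := (ε.surjective.range_comp Subtype.val).trans Subtype.range_coe
  -- The Leibniz formula permutes the rows of `A`, whereas `e ∘ σ` permutes columns; hence the
  -- passage to inverse permutations.
  rw [← hD K e hinj hrange, Matrix.det_apply' (A.submatrix id e), ← Equiv.sum_comp (Equiv.inv (Equiv.Perm ι)),
    Finset.sum_mul]
  symm
  refine Finset.sum_bij (fun σ _ => e ∘ σ) ?_ ?_ ?_ ?_
  · intro σ _
    have h6 : Finset.univ.image (e ∘ σ) = K := by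
      rw [← Finset.coe_inj, Finset.coe_image, Finset.coe_univ, Set.image_univ,
        (Equiv.surjective _).range_comp, hrange]
    simpa [h6] using hinj
  · intro σ _ τ _ h
    ext i
    have := congrFun h i
    simpa using hinj this
  · intro f hf
    simp only [Finset.mem_filter, Finset.mem_univ, true_and] at hf
    have h7 (i : ι) : ∃ j, e j = f i := by
      have : f i ∈ (K : Set E) := by
        rw [← hf.2]; simp
      rwa [← hrange] at this
    choose g hg using h7
    have hgi : Function.Injective g := fun i j hij => hf.1 (by rw [← hg i, ← hg j, hij])
    refine ⟨Equiv.ofBijective g (Finite.injective_iff_bijective.1 hgi), Finset.mem_univ _, ?_⟩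
    funext i
    simpa using hg i
  · intro σ _
    have h8 : B.submatrix (e ∘ σ) id = (B.submatrix e id).submatrix σ id := by
      ext; simp
    rw [h8, Matrix.det_permute]
    have h9 : ∏ i, (A.submatrix id e) ((Equiv.inv (Equiv.Perm ι) σ) i) i =
        ∏ i, A i ((e ∘ σ) i) := by
      rw [← Equiv.prod_comp σ]
      simp
    rw [h9]
    simp
    ring

/-! ### Minors of the differential matrix and integral cycles -/

namespace OrientedGraph

variable {V E : Type*} (G : OrientedGraph V E)

theorem eq_of_spanningConnected {K : Finset E} (hK : G.SpanningConnected K) {α : Type*} {f : V → α}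
    (hf : ∀ e ∈ K, f (G.tgt e) = f (G.src e)) (v w : V) : f v = f w := by
  have h := (SimpleGraph.reachable_iff_reflTransGen v w).1 (hK.preconnected v w)
  induction h with
  | refl => rfl
  | tail _ h ih =>
    rw [SimpleGraph.fromRel_adj] at h
    rcases h.2 with ⟨e, he, rfl, rfl⟩ | ⟨e, he, rfl, rfl⟩
    · rw [ih, hf e he]
    · rw [ih, hf e he]

theorem exists_of_not_spanningConnected {K : Finset E} (hK : ¬ G.SpanningConnected K)
    (R : Type*) [MulZeroOneClass R] [Nontrivial R] (v₀ : V) :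
    ∃ f : V → R, f ≠ 0 ∧ f v₀ = 0 ∧ ∀ e ∈ K, f (G.tgt e) = f (G.src e) := by
  classical
  let H := SimpleGraph.fromRel fun v w : V => ∃ e ∈ K, G.src e = v ∧ G.tgt e = w
  -- The indicator of the complement of the component of `v₀`.
  refine ⟨fun v => if H.Reachable v₀ v then 0 else 1, fun h => hK ?_, by simp, fun e he => ?_⟩
  · have h1 (v : V) : H.Reachable v₀ v := by
      by_contra h2
      simpa [h2] using congrFun h v
    exact (SimpleGraph.connected_iff _).2 ⟨fun v w => (h1 v).symm.trans (h1 w), ⟨v₀⟩⟩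
  · have h1 : H.Reachable (G.src e) (G.tgt e) := by
      by_cases h : G.src e = G.tgt e
      · rw [h]
      · exact SimpleGraph.Adj.reachable
          ((SimpleGraph.fromRel_adj _ _ _).2 ⟨h, Or.inl ⟨e, he, rfl, rfl⟩⟩)
    have h2 : H.Reachable v₀ (G.tgt e) ↔ H.Reachable v₀ (G.src e) :=
      ⟨fun h => h.trans h1.symm, fun h => h.trans h1⟩
    simp only [h2]

variable [DecidableEq V]

/-- The matrix whose columns are the differentials of the indicator functions of the vertices
`v ≠ v₀`, followed by the forms `θ i`. -/
def differentialMatrix {𝕜 : Type*} [Ring 𝕜] {k : ℕ} (v₀ : V) (θ : Fin k → E → 𝕜) :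
    Matrix E ({v // v ≠ v₀} ⊕ Fin k) 𝕜 :=
  Matrix.of fun e => Sum.elim
    (fun v => (Pi.single v.1 1 : V → 𝕜) (G.tgt e) - (Pi.single v.1 1 : V → 𝕜) (G.src e))
    (fun i => θ i e)

/-- A function vanishing at `v₀` is a combination of the remaining indicators, so one that is
constant along the edges of `K` gives a kernel vector, with zero coefficients on the forms `θ i`. -/
theorem det_differentialMatrix_of_not_spanningConnected [Fintype V] {𝕜 : Type*} [CommRing 𝕜]
    [IsDomain 𝕜] {k : ℕ} (v₀ : V) (θ : Fin k → E → 𝕜) {K : Finset E}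
    (hK : ¬ G.SpanningConnected K) {e : {v // v ≠ v₀} ⊕ Fin k → E} (he : ∀ i, e i ∈ K) :
    ((G.differentialMatrix v₀ θ).submatrix e id).det = 0 := by
  obtain ⟨f, hf, hf0, hfK⟩ := G.exists_of_not_spanningConnected hK 𝕜 v₀
  refine Matrix.exists_mulVec_eq_zero_iff.1 ⟨Sum.elim (fun v => f v) 0, fun h => hf ?_, ?_⟩
  · ext v
    by_cases hv : v = v₀
    · rw [hv, hf0, Pi.zero_apply]
    · exact congrFun h (Sum.inl ⟨v, hv⟩)
  · ext i
    have h1 (w : V) : ∑ v : {v // v ≠ v₀}, (Pi.single v.1 1 : V → 𝕜) w * f v = f w := by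
      have h2 := Fintype.sum_eq_add_sum_subtype_ne
        (fun v : V => (Pi.single v 1 : V → 𝕜) w * f v) v₀
      rw [hf0, mul_zero, zero_add] at h2
      rw [← h2]
      simp [Pi.single_apply]
    simp only [Matrix.mulVec, dotProduct, differentialMatrix, Matrix.submatrix_apply, id,
      Matrix.of_apply, Fintype.sum_sum_type, Sum.elim_inl, Sum.elim_inr, sub_mul,
      Finset.sum_sub_distrib, h1, hfK _ (he i), Pi.zero_apply, mul_zero, Finset.sum_const_zero,
      sub_self, add_zero]

variable [Fintype E]

theorem boundary_apply (c : E → ℤ) (v : V) :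
    G.boundary c v = ∑ e, c e *
      ((Pi.single (G.tgt e) 1 : V → ℤ) v - (Pi.single (G.src e) 1 : V → ℤ) v) := by
  simp [boundary, Finset.sum_apply]

theorem sum_boundary [Fintype V] (c : E → ℤ) : ∑ v, G.boundary c v = 0 := by
  simp only [boundary_apply]
  rw [Finset.sum_comm]
  refine Finset.sum_eq_zero fun e _ => ?_
  rw [← Finset.mul_sum, Finset.sum_sub_distrib]
  simp

theorem boundary_single [DecidableEq E] (e : E) (r : ℤ) :
    G.boundary (Pi.single e r) = r • (Pi.single (G.tgt e) 1 - Pi.single (G.src e) 1) := by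
  ext v
  rw [boundary_apply, Finset.sum_eq_single e]
  · simp
  · intro e' _ h
    simp [h]
  · simp

/-- A connected spanning subgraph contains a chain joining any two vertices. -/
theorem exists_chain_of_spanningConnected {K : Finset E} (hK : G.SpanningConnected K) (v w : V) :
    ∃ c : E → ℤ, (∀ e ∉ K, c e = 0) ∧ G.boundary c = Pi.single w 1 - Pi.single v 1 := by
  classical
  have h := (SimpleGraph.reachable_iff_reflTransGen v w).1 (hK.preconnected v w)
  have key (e : E) (he : e ∈ K) (r : ℤ) (e' : E) (he' : e' ∉ K) :
      (Pi.single e r : E → ℤ) e' = 0 := by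
    rw [Pi.single_eq_of_ne (fun h => he' (by rw [h]; exact he))]
  induction h with
  | refl => exact ⟨0, by simp, by simp⟩
  | tail _ h ih =>
    obtain ⟨c, hc, hc'⟩ := ih
    rw [SimpleGraph.fromRel_adj] at h
    rcases h.2 with ⟨e, he, rfl, rfl⟩ | ⟨e, he, rfl, rfl⟩
    · refine ⟨c + Pi.single e 1, fun e' he' => ?_, ?_⟩
      · rw [Pi.add_apply, hc e' he', key e he _ e' he', add_zero]
      · rw [map_add, hc', boundary_single]
        module
    -- The path traverses `e` against its orientation.
    · refine ⟨c + Pi.single e (-1), fun e' he' => ?_, ?_⟩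
      · rw [Pi.add_apply, hc e' he', key e he _ e' he', add_zero]
      · rw [map_add, hc', boundary_single]
        module

/-- For a connected spanning subgraph `K`, a basis of the group of integral cycles extends to a
basis of the group of integral chains by chains that join `v₀` to the other vertices. -/
theorem exists_basis_of_spanningConnected [Fintype V] {K : Finset E} (hK : G.SpanningConnected K)
    (v₀ : V) {m : ℕ} (γ : Module.Basis (Fin m) ℤ (G.cycles K)) :
    ∃ b : Module.Basis ({v // v ≠ v₀} ⊕ Fin m) ℤ (K → ℤ),
      (∀ v, G.boundary (Function.ExtendByZero.linearMap ℤ (Subtype.val : K → E) (b (Sum.inl v))) =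
        Pi.single v.1 1 - Pi.single v₀ 1) ∧
      ∀ j, Function.ExtendByZero.linearMap ℤ (Subtype.val : K → E) (b (Sum.inr j)) = γ j := by
  classical
  choose s hs hs' using fun w => G.exists_chain_of_spanningConnected hK v₀ w
  let T := Function.ExtendByZero.linearMap ℤ (Subtype.val : K → E)
  let R : (E → ℤ) →ₗ[ℤ] (K → ℤ) := LinearMap.funLeft ℤ ℤ Subtype.val
  have hRT (c) : R (T c) = c := by
    ext e
    exact Subtype.val_injective.extend_apply _ _ _
  have hTR (c : E → ℤ) (hc : ∀ e ∉ K, c e = 0) : T (R c) = c := by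
    ext e
    by_cases he : e ∈ K
    · exact Subtype.val_injective.extend_apply _ _ (⟨e, he⟩ : K)
    · rw [hc e he]
      exact Function.extend_apply' _ _ _ (by rintro ⟨a, rfl⟩; exact he a.2)
  let g : {v // v ≠ v₀} ⊕ Fin m → (K → ℤ) :=
    Sum.elim (fun v => R (s v)) (fun j => R (γ j : E → ℤ))
  have hg1 (v) : T (g (Sum.inl v)) = s v := hTR _ (hs v)
  have hg2 (j) : T (g (Sum.inr j)) = γ j := hTR _ (γ j).2.2
  have hli : LinearIndependent ℤ g := by
    rw [Fintype.linearIndependent_iff]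
    intro a ha
    have h1 := congrArg T ha
    rw [map_sum, map_zero, Fintype.sum_sum_type] at h1
    simp only [map_smul, hg1, hg2] at h1
    -- The boundary kills the cycles, and among the paths only the one ending at `v ≠ v₀` has a
    -- nonzero boundary coefficient at `v`.
    have h2 (v) : a (Sum.inl v) = 0 := by
      have h3 := congrArg G.boundary h1
      have h4 (j) : G.boundary (γ j : E → ℤ) = 0 := (γ j).2.1
      simp only [map_add, map_sum, map_smul, hs', h4, smul_zero, Finset.sum_const_zero, add_zero,
        map_zero] at h3
      have h5 := congrFun h3 v.1
      rw [Finset.sum_apply, Finset.sum_eq_single v] at h5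
      · simpa [Pi.single_eq_of_ne v.2] using h5
      · intro w _ hw
        have : v.1 ≠ w.1 := fun h => hw (Subtype.ext h.symm)
        simp [Pi.single_eq_of_ne v.2, Pi.single_eq_of_ne this]
      · simp
    simp only [h2, zero_smul, Finset.sum_const_zero, zero_add] at h1
    have h6 : ∑ j, a (Sum.inr j) • γ j = 0 := by
      apply Subtype.ext
      simpa using h1
    have h7 := Fintype.linearIndependent_iff.1 γ.linearIndependent _ h6
    rintro (v | j)
    · exact h2 v
    · exact h7 j
  have hsp : ⊤ ≤ Submodule.span ℤ (Set.range g) := by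
    intro c _
    -- Removing the paths that carry the boundary of `c` leaves a cycle: the coefficients of a
    -- boundary sum to zero, so the one at `v₀` is accounted for.
    let z : E → ℤ := T c - ∑ v : {v // v ≠ v₀}, G.boundary (T c) v • s v
    have hz : z ∈ G.cycles K := by
      refine ⟨?_, fun e he => ?_⟩
      · have h1 : G.boundary (T c) =
            ∑ v : V, G.boundary (T c) v • ((Pi.single v 1 : V → ℤ) - Pi.single v₀ 1) := by
          simp only [smul_sub, Finset.sum_sub_distrib]
          rw [← Finset.sum_smul, sum_boundary, zero_smul, sub_zero]
          ext w
          simp [Finset.sum_apply, Pi.single_apply]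
        rw [Fintype.sum_eq_add_sum_subtype_ne _ v₀, sub_self, smul_zero, zero_add] at h1
        simp only [z, map_sub, map_sum, map_smul, hs']
        rw [← h1, sub_self]
      · have h1 : T c e = 0 :=
          Function.extend_apply' _ _ _ (by rintro ⟨a, rfl⟩; exact he a.2)
        simp only [z, Pi.sub_apply, h1, Finset.sum_apply, Pi.smul_apply, hs _ e he, smul_zero,
          Finset.sum_const_zero, sub_zero]
    have h2 : c = ∑ v : {v // v ≠ v₀}, G.boundary (T c) v • g (Sum.inl v) +
        ∑ j, γ.repr ⟨z, hz⟩ j • g (Sum.inr j) := by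
      have h3 : ∑ j, γ.repr ⟨z, hz⟩ j • (γ j : E → ℤ) = z := by
        have := congrArg (Submodule.subtype _) (γ.sum_repr ⟨z, hz⟩)
        simp only [map_sum, map_smul] at this
        exact this
      rw [← hRT c, hRT c]
      have h4 : R z = ∑ j, γ.repr ⟨z, hz⟩ j • g (Sum.inr j) := by
        have h6 := (congrArg R h3).symm
        simp only [map_sum, map_smul] at h6
        exact h6
      have h5 : R z = c - ∑ v : {v // v ≠ v₀}, G.boundary (T c) v • g (Sum.inl v) := by
        simp only [z, map_sub, map_sum, map_smul, hRT]
        rfl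
      rw [← h4, h5]
      abel
    rw [h2]
    refine add_mem (sum_mem fun v _ => ?_) (sum_mem fun j _ => ?_) <;>
    exact Submodule.smul_mem _ _ (Submodule.subset_span (Set.mem_range_self _))
  refine ⟨Module.Basis.mk hli hsp, fun v => ?_, fun j => ?_⟩
  · rw [Module.Basis.mk_apply]
    exact (congrArg _ (hg1 v)).trans (hs' v)
  · rw [Module.Basis.mk_apply]
    exact hg2 j

/-- Euler's relation, from the rank of `ℤ^K` computed in the standard basis and in the basis of
paths and cycles. -/
theorem card_of_spanningConnected [Fintype V] {K : Finset E} (hK : G.SpanningConnected K)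
    (v₀ : V) : K.card = Fintype.card ({v // v ≠ v₀} ⊕ Fin (Module.finrank ℤ (G.cycles K))) := by
  obtain ⟨b, -⟩ := G.exists_basis_of_spanningConnected hK v₀ (Module.finBasis ℤ (G.cycles K))
  rw [← Module.finrank_eq_card_basis b, Module.finrank_fintype_fun_eq_card, Fintype.card_coe]

/-- Pairing the columns of `M_K` with paths and cycles is a unimodular change of basis, and it
reduces the minor to the periods of `θ` along the cycles. -/
theorem norm_det_differentialMatrix [Fintype V] {𝕜 : Type*} [RCLike 𝕜] {k : ℕ} (v₀ : V)
    (θ : Fin k → E → 𝕜) {K : Finset E} (hK : G.SpanningConnected K)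
    (γ : Module.Basis (Fin k) ℤ (G.cycles K)) {e : {v // v ≠ v₀} ⊕ Fin k → E}
    (he : Function.Injective e) (heK : Set.range e = K) :
    ‖((G.differentialMatrix v₀ θ).submatrix e id).det‖ =
      ‖Matrix.det (Matrix.of fun i j => ∑ e, θ i e * (((γ j : E → ℤ) e : ℤ) : 𝕜))‖ := by
  classical
  obtain ⟨b, hb1, hb2⟩ := G.exists_basis_of_spanningConnected hK v₀ γ
  let T := Function.ExtendByZero.linearMap ℤ (Subtype.val : K → E)
  let e' : {v // v ≠ v₀} ⊕ Fin k ≃ K :=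
    (Equiv.ofInjective e he).trans (Equiv.setCongr heK)
  let b' := b.map (LinearEquiv.funCongrLeft ℤ ℤ e')
  let P : Matrix ({v // v ≠ v₀} ⊕ Fin k) ({v // v ≠ v₀} ⊕ Fin k) ℤ :=
    (Pi.basisFun ℤ ({v // v ≠ v₀} ⊕ Fin k)).toMatrix b'
  have hP : IsUnit P.det := (Pi.basisFun ℤ ({v // v ≠ v₀} ⊕ Fin k)).isUnit_det b'
  have hPa (i j) : P i j = b j (e' i) := rfl
  have hsum (F : E → 𝕜) (j) : ∑ i, F (e i) * ((P i j : ℤ) : 𝕜) =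
      ∑ a : E, F a * ((T (b j) a : ℤ) : 𝕜) := by
    rw [← Finset.sum_subset (Finset.subset_univ K)]
    · rw [← Finset.sum_coe_sort K fun a => F a * ((T (b j) a : ℤ) : 𝕜), ← Equiv.sum_comp e']
      refine Finset.sum_congr rfl fun i _ => ?_
      rw [hPa]
      congr 2
      exact (Subtype.val_injective.extend_apply (b j) 0 (e' i)).symm
    · intro a _ ha
      have : T (b j) a = 0 :=
        Function.extend_apply' _ _ _ (by rintro ⟨a, rfl⟩; exact ha a.2)
      rw [this, Int.cast_zero, mul_zero]
  let M := (G.differentialMatrix v₀ θ).submatrix e id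
  let Q := P.map (Int.castRingHom 𝕜)
  have hblock : M.transpose * Q = Matrix.fromBlocks 1 0
      (Matrix.of fun i v => ∑ a, θ i a * ((T (b (Sum.inl v)) a : ℤ) : 𝕜))
      (Matrix.of fun i j => ∑ e, θ i e * (((γ j : E → ℤ) e : ℤ) : 𝕜)) := by
    -- Duality of `d` and `∂`: this yields the identity block on paths and the zero block on cycles.
    have hd (v : {v // v ≠ v₀}) (c : E → ℤ) :
        ∑ a, G.differentialMatrix v₀ θ a (Sum.inl v) * ((c a : ℤ) : 𝕜) =
          ((G.boundary c v : ℤ) : 𝕜) := by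
      rw [boundary_apply, Int.cast_sum]
      refine Finset.sum_congr rfl fun a _ => ?_
      simp [differentialMatrix, Pi.single_apply, mul_comm, eq_comm]
    ext i j
    have h1 : (M.transpose * Q) i j =
        ∑ a, G.differentialMatrix v₀ θ a i * ((T (b j) a : ℤ) : 𝕜) := by
      rw [← hsum]
      rfl
    rw [h1]
    rcases i with v | i <;> rcases j with w | j
    · rw [hd, hb1, Matrix.fromBlocks_apply₁₁, Matrix.one_apply]
      simp [Pi.single_eq_of_ne v.2, Pi.single_apply, Subtype.ext_iff]
    · rw [hd, hb2, (γ j).2.1]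
      simp
    · rfl
    · rw [hb2]
      rfl
  have hdet := congrArg Matrix.det hblock
  rw [Matrix.det_fromBlocks_zero₁₂, Matrix.det_one, one_mul, Matrix.det_mul, Matrix.det_transpose]
    at hdet
  rw [← hdet, norm_mul]
  have hQ : Q.det = ((P.det : ℤ) : 𝕜) := ((Int.castRingHom 𝕜).map_det P).symm
  have hQ1 : ‖Q.det‖ = 1 := by
    rw [hQ]
    rcases Int.isUnit_iff.1 hP with h | h <;> simp [h]
  rw [hQ1, mul_one]

end OrientedGraph

/-! ### Gram matrices and the determinant of the augmented Laplacian -/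

/-- Expanding `A^* A b_j` in `b` and pairing with `b_i`; this gives access to `det (A^* A)` without
an orthonormal basis. -/
theorem Matrix.gram_mul_toMatrix_adjoint_comp_self {𝕜 H F ι : Type*} [RCLike 𝕜]
    [NormedAddCommGroup H] [InnerProductSpace 𝕜 H] [FiniteDimensional 𝕜 H]
    [NormedAddCommGroup F] [InnerProductSpace 𝕜 F] [FiniteDimensional 𝕜 F]
    [Fintype ι] [DecidableEq ι] (b : Module.Basis ι 𝕜 H) (A : H →ₗ[𝕜] F) :
    Matrix.gram 𝕜 b * LinearMap.toMatrix b b (A.adjoint ∘ₗ A) = Matrix.gram 𝕜 (A ∘ b) := by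
  ext i j
  rw [Matrix.mul_apply, Matrix.gram_apply, Function.comp_apply, Function.comp_apply,
    ← LinearMap.adjoint_inner_right, ← LinearMap.comp_apply]
  conv_rhs => rw [← b.sum_repr ((A.adjoint ∘ₗ A) (b j)), inner_sum]
  refine Finset.sum_congr rfl fun l _ => ?_
  rw [inner_smul_right, LinearMap.toMatrix_apply, Matrix.gram_apply, mul_comm]

namespace OrientedGraph

variable {V E : Type*} (G : OrientedGraph V E) {𝕜 : Type*} [RCLike 𝕜]
  (x : PosWeight E)

theorem differential_apply (f : EuclideanSpace 𝕜 V) (e : E) :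
    (WeightedSpace.of x).symm (G.differential 𝕜 x f) e = f (G.tgt e) - f (G.src e) := rfl

theorem differential_const (c : 𝕜) : G.differential 𝕜 x (WithLp.toLp 2 fun _ => c) = 0 := by
  apply (WeightedSpace.of x).symm.injective
  ext e
  rw [differential_apply]
  simp

variable [Fintype V] [Fintype E]

theorem sum_eq_zero_of_mem_range_adjoint {f : EuclideanSpace 𝕜 V}
    (hf : f ∈ (G.differential 𝕜 x).adjoint.range) : ∑ v, f v = 0 := by
  obtain ⟨g, rfl⟩ := hf
  have h := LinearMap.adjoint_inner_right (G.differential 𝕜 x) (WithLp.toLp 2 fun _ => 1) g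
  rw [differential_const, inner_zero_left, PiLp.inner_apply] at h
  simpa using h

/-- For a connected graph, the orthogonal projections of the indicator functions of the vertices
`v ≠ v₀` are a basis of `im d^*`. -/
theorem exists_basis_range_adjoint [DecidableEq V] (hG : G.SpanningConnected Finset.univ)
    (v₀ : V) :
    ∃ b : Module.Basis {v // v ≠ v₀} 𝕜 (G.differential 𝕜 x).adjoint.range,
      ∀ v, (b v : EuclideanSpace 𝕜 V) =
        EuclideanSpace.single v.1 1 - WithLp.toLp 2 fun _ => (Fintype.card V : 𝕜)⁻¹ := by
  have hn : (Fintype.card V : 𝕜) ≠ 0 := Nat.cast_ne_zero.2 (Fintype.card_pos_iff.2 ⟨v₀⟩).ne'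
  let g (v : V) : EuclideanSpace 𝕜 V :=
    EuclideanSpace.single v 1 - WithLp.toLp 2 fun _ => (Fintype.card V : 𝕜)⁻¹
  have hga (v w : V) : g v w = (if w = v then 1 else 0) - (Fintype.card V : 𝕜)⁻¹ := by
    simp [g]
  have hmem (v : V) : g v ∈ (G.differential 𝕜 x).adjoint.range := by
    -- `im d^*` is the orthogonal complement of `ker d`, which by connectedness consists of
    -- constants.
    rw [← LinearMap.orthogonal_ker, Submodule.mem_orthogonal]
    intro u hu
    have hu' (w : V) : u w = u v := by
      refine G.eq_of_spanningConnected hG (f := fun w => u w) (fun e _ => ?_) w v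
      have := G.differential_apply x u e
      rw [LinearMap.mem_ker.1 hu] at this
      exact (sub_eq_zero.1 (by simpa using this.symm))
    rw [PiLp.inner_apply]
    simp only [hga, hu', RCLike.inner_apply, ← Finset.sum_mul, Finset.sum_sub_distrib]
    simp [hn]
  have hli : LinearIndependent 𝕜
      fun v : {v // v ≠ v₀} => (⟨g v, hmem v⟩ : (G.differential 𝕜 x).adjoint.range) := by
    rw [Fintype.linearIndependent_iff]
    intro a ha
    have h1 (w : V) : ∑ v, a v * g v w = 0 := by
      have := congrArg (fun f : (G.differential 𝕜 x).adjoint.range => (f : EuclideanSpace 𝕜 V) w) ha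
      simpa using this
    simp only [hga, mul_sub, Finset.sum_sub_distrib, mul_ite, mul_one, mul_zero] at h1
    -- At `v₀` all indicators vanish, so the constant term is zero; evaluation at `v` then isolates
    -- `a v`.
    have h2 := h1 v₀
    rw [Finset.sum_eq_zero (fun v _ => if_neg v.2.symm), zero_sub, neg_eq_zero] at h2
    intro v
    simpa [h2, Subtype.coe_inj] using h1 v
  have hsp : ⊤ ≤ Submodule.span 𝕜 (Set.range
      fun v : {v // v ≠ v₀} => (⟨g v, hmem v⟩ : (G.differential 𝕜 x).adjoint.range)) := by
    intro f _
    have h0 := G.sum_eq_zero_of_mem_range_adjoint x f.2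
    -- The projections of all indicators sum to zero, so subtracting `f v₀` from every coefficient
    -- changes nothing and removes the term of `v₀`.
    have h1 : f = ∑ v : {v // v ≠ v₀}, (f.1 v - f.1 v₀) •
        (⟨g v, hmem v⟩ : (G.differential 𝕜 x).adjoint.range) := by
      apply Subtype.ext
      ext w
      have h2 := Fintype.sum_eq_add_sum_subtype_ne (fun v => (f.1 v - f.1 v₀) * g v w) v₀
      rw [sub_self, zero_mul, zero_add] at h2
      have h3 : f.1 w = ∑ v, (f.1 v - f.1 v₀) * g v w := by
        simp only [hga, mul_sub, Finset.sum_sub_distrib, ← Finset.sum_mul, h0]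
        simp [mul_right_comm _ _ (Fintype.card V : 𝕜)⁻¹, hn]
      rw [h3, h2]
      simp
    rw [h1]
    exact sum_mem fun v _ => Submodule.smul_mem _ _ (Submodule.subset_span (Set.mem_range_self v))
  exact ⟨Module.Basis.mk hli hsp, fun v => by rw [Module.Basis.mk_apply]⟩

/-- A rank-one perturbation of the identity: `1 - (|V| - 1) / |V| = 1 / |V|`. -/
theorem det_one_sub_inv_card [DecidableEq V] (v₀ : V) :
    (Matrix.of fun v w : {v // v ≠ v₀} =>
      (if v = w then 1 else 0) - (Fintype.card V : 𝕜)⁻¹).det = (Fintype.card V : 𝕜)⁻¹ := by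
  have hn : (Fintype.card V : 𝕜) ≠ 0 := Nat.cast_ne_zero.2 (Fintype.card_pos_iff.2 ⟨v₀⟩).ne'
  have h := Matrix.det_one_add_replicateCol_mul_replicateRow (ι := Unit)
    (fun _ : {v // v ≠ v₀} => -(Fintype.card V : 𝕜)⁻¹) (fun _ => 1)
  have h1 : (1 + Matrix.replicateCol Unit (fun _ : {v // v ≠ v₀} => -(Fintype.card V : 𝕜)⁻¹) *
      Matrix.replicateRow Unit (fun _ => (1 : 𝕜))) = Matrix.of fun v w : {v // v ≠ v₀} =>
      (if v = w then 1 else 0) - (Fintype.card V : 𝕜)⁻¹ := by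
    ext v w
    simp [Matrix.mul_apply, Matrix.one_apply, sub_eq_add_neg]
  rw [← h1, h]
  have h2 : (Fintype.card {v // v ≠ v₀} : 𝕜) = Fintype.card V - 1 := by
    rw [Fintype.card_subtype_compl, Fintype.card_subtype_eq,
      Nat.cast_sub (Fintype.card_pos_iff.2 ⟨v₀⟩), Nat.cast_one]
  simp only [dotProduct, one_mul, Finset.sum_const, Finset.card_univ, nsmul_eq_mul, h2]
  field_simp
  ring

variable [DecidableEq V] [Nonempty V] {k : ℕ}

/-- The determinant of the augmented Laplacian, as the determinant of a Gram matrix. -/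
theorem det_augmentedLaplacian (hG : G.SpanningConnected Finset.univ) (v₀ : V)
    (θ : Fin k → E → 𝕜) [DecidableEq E] :
    (Fintype.card V : 𝕜) ^ ((k : ℤ) - 1) * LinearMap.det (G.augmentedLaplacian x θ) =
      ((G.differentialMatrix v₀ θ).conjTranspose *
        (Matrix.diagonal (fun e => (x.1 e : 𝕜)) * G.differentialMatrix v₀ θ)).det := by
  have hn : (Fintype.card V : 𝕜) ≠ 0 := Nat.cast_ne_zero.2 Fintype.card_ne_zero
  obtain ⟨b₁, hb₁⟩ := G.exists_basis_range_adjoint (𝕜 := 𝕜) x hG v₀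
  let b₂ := (Pi.basisFun 𝕜 (Fin k)).map (WeightedSpace.of (cardWeight V k))
  have hb₂ (i j) : (WeightedSpace.of (cardWeight V k)).symm (b₂ i) j = if j = i then 1 else 0 := by
    simp [b₂, Pi.single_apply]
  let b := (b₁.prod b₂).map (WithLp.linearEquiv 2 𝕜
    ((G.differential 𝕜 x).adjoint.range × WeightedSpace 𝕜 (cardWeight V k))).symm
  have hbl (v) : b (Sum.inl v) = WithLp.toLp 2 (b₁ v, 0) := by simp [b]
  have hbr (i) : b (Sum.inr i) = WithLp.toLp 2 (0, b₂ i) := by simp [b]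
  have hgram : Matrix.gram 𝕜 b = Matrix.fromBlocks
      (Matrix.of fun v w : {v // v ≠ v₀} => (if v = w then 1 else 0) - (Fintype.card V : 𝕜)⁻¹) 0 0
      (Matrix.diagonal fun _ => (Fintype.card V : 𝕜)) := by
    ext (v | i) (w | j)
    · rw [Matrix.gram_apply, hbl, hbl, WithLp.prod_inner_apply]
      simp only [Submodule.coe_inner, hb₁, PiLp.inner_apply, inner_zero_left, add_zero]
      simp [sub_mul, mul_sub, Finset.sum_sub_distrib, hn, Subtype.ext_iff]
    · rw [Matrix.gram_apply, hbl, hbr, WithLp.prod_inner_apply]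
      simp
    · rw [Matrix.gram_apply, hbl, hbr, WithLp.prod_inner_apply]
      simp
    · rw [Matrix.gram_apply, hbr, hbr, WithLp.prod_inner_apply]
      simp only [inner_zero_left, zero_add]
      rw [WeightedSpace.inner_def]
      simp only [hb₂]
      simp [cardWeight, Matrix.diagonal_apply, eq_comm]
  -- The exponent is an integer because it is `-1` when `k = 0`.
  have hdet : (Matrix.gram 𝕜 b).det = (Fintype.card V : 𝕜) ^ ((k : ℤ) - 1) := by
    rw [hgram, Matrix.det_fromBlocks_zero₁₂, det_one_sub_inv_card, Matrix.det_diagonal,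
      zpow_sub₀ hn, zpow_natCast, zpow_one]
    simp [div_eq_inv_mul]
  -- The constant subtracted by the projection cancels in the difference along `e`.
  have hA (i) (e : E) : (WeightedSpace.of x).symm (G.augmentedDifferential x θ (b i)) e =
      G.differentialMatrix v₀ θ e i := by
    rcases i with v | i
    · have h1 : G.augmentedDifferential x θ (b (Sum.inl v)) = G.differential 𝕜 x (b₁ v) := by
        simp [augmentedDifferential, hbl]
      rw [h1, differential_apply, hb₁]
      simp [differentialMatrix, Pi.single_apply]
    · have h1 : G.augmentedDifferential x θ (b (Sum.inr i)) = omega x θ (b₂ i) := by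
        simp [augmentedDifferential, hbr]
      rw [h1]
      simp [omega, b₂, differentialMatrix]
  have hgramA : Matrix.gram 𝕜 (G.augmentedDifferential x θ ∘ b) =
      (G.differentialMatrix v₀ θ).conjTranspose *
        (Matrix.diagonal (fun e => (x.1 e : 𝕜)) * G.differentialMatrix v₀ θ) := by
    ext i j
    rw [Matrix.gram_apply, Matrix.mul_apply, WeightedSpace.inner_def]
    refine Finset.sum_congr rfl fun e _ => ?_
    rw [Function.comp_apply, Function.comp_apply, hA, hA, Matrix.diagonal_mul,
      Matrix.conjTranspose_apply, RCLike.star_def]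
    ring
  rw [← hdet, ← LinearMap.det_toMatrix b, ← Matrix.det_mul, augmentedLaplacian,
    Matrix.gram_mul_toMatrix_adjoint_comp_self, hgramA]

end OrientedGraph

/-! ### The sum over connected spanning subgraphs -/

theorem mainTheorem7 {𝕜 : Type*} [RCLike 𝕜] {V E : Type*} [Fintype V] [DecidableEq V] [Nonempty V]
    [Fintype E] (G : OrientedGraph V E) (hG : G.SpanningConnected Finset.univ)
    (x : PosWeight E) (k : ℕ) (θ : Fin k → E → 𝕜) :
    ((MvPolynomial.eval x.1 (G.connectedPolynomial (exteriorPower.ιMulti 𝕜 k θ)) : ℝ) : 𝕜) =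
      (Fintype.card V : 𝕜) ^ ((k : ℤ) - 1) * LinearMap.det (G.augmentedLaplacian x θ) := by
  classical
  have v₀ : V := Classical.arbitrary V
  let M := G.differentialMatrix v₀ θ
  have hterm (K : Finset E) (e : {v // v ≠ v₀} ⊕ Fin k → E) (hinj : Function.Injective e)
      (hrange : Set.range e = K) :
      (M.conjTranspose.submatrix id e).det *
        ((Matrix.diagonal (fun e => (x.1 e : 𝕜)) * M).submatrix e id).det =
        ((‖(M.submatrix e id).det‖ ^ 2 * ∏ a ∈ K, x.1 a : ℝ) : 𝕜) := by
    have h1 : (Matrix.diagonal (fun e => (x.1 e : 𝕜)) * M).submatrix e id =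
        Matrix.diagonal (fun i => (x.1 (e i) : 𝕜)) * M.submatrix e id := by
      ext i j
      simp [Matrix.diagonal_mul]
    have h2 : M.conjTranspose.submatrix id e = (M.submatrix e id).conjTranspose := rfl
    have h3 : ∏ i, (x.1 (e i) : 𝕜) = ∏ a ∈ K, (x.1 a : 𝕜) := by
      have h4 : K = Finset.univ.image e := by
        rw [← Finset.coe_inj, Finset.coe_image, Finset.coe_univ, Set.image_univ, hrange]
      rw [h4, Finset.prod_image fun i _ j _ h => hinj h]
    rw [h1, h2, Matrix.det_mul, Matrix.det_diagonal, Matrix.det_conjTranspose, h3, RCLike.star_def,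
      mul_left_comm, RCLike.conj_mul]
    push_cast
    ring
  -- Choosing `z_K` requires the rank condition; the default `0` is the true value of the term for
  -- the other `K` of the right cardinality.
  let D (K : Finset E) : ℝ := if h : K ∈ G.connectedSubgraphs k then
    ‖OrientedGraph.extPairing (exteriorPower.ιMulti 𝕜 k θ)
      (G.cycleWedge 𝕜 (G.mem_connectedSubgraphs.1 h).2)‖ ^ 2 * ∏ e ∈ K, x.1 e else 0
  have hcard {K : Finset E} (hK : K ∈ G.connectedSubgraphs k) :
      K.card = Fintype.card ({v // v ≠ v₀} ⊕ Fin k) := by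
    obtain ⟨h1, h2⟩ := G.mem_connectedSubgraphs.1 hK
    rw [G.card_of_spanningConnected h1 v₀, h2]
  rw [G.det_augmentedLaplacian x hG v₀,
    Matrix.det_mul_eq_sum_of_forall_injective _ _ fun K => ((D K : ℝ) : 𝕜)]
  · have hsum : ∑ K ∈ G.connectedSubgraphs k, D K =
        ∑ K ∈ Finset.univ.powersetCard (Fintype.card ({v // v ≠ v₀} ⊕ Fin k)), D K :=
      Finset.sum_subset (fun K hK => Finset.mem_powersetCard_univ.2 (hcard hK))
        fun K _ hK => dif_neg hK
    rw [← RCLike.ofReal_sum, OrientedGraph.connectedPolynomial, map_sum, ← hsum,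
      ← Finset.sum_attach (G.connectedSubgraphs k) D]
    refine congrArg (fun r : ℝ => (r : 𝕜)) (Finset.sum_congr rfl fun K _ => ?_)
    simp only [D, dif_pos K.2]
    simp
  · intro K e hinj hrange
    rw [hterm K e hinj hrange]
    congr 1
    by_cases hK : K ∈ G.connectedSubgraphs k
    · obtain ⟨h1, h2⟩ := G.mem_connectedSubgraphs.1 hK
      simp only [D, dif_pos hK]
      rw [G.norm_det_differentialMatrix v₀ θ h1
        (Module.finBasisOfFinrankEq ℤ (G.cycles K) h2) hinj hrange, OrientedGraph.cycleWedge,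
        OrientedGraph.extPairing_ιMulti_wedgeChains]
    -- Euler's relation and the cardinality of `K` force the rank `k` once `K` is connected, so only
    -- connectedness can fail.
    · have h1 : ¬ G.SpanningConnected K := by
        intro h2
        refine hK (G.mem_connectedSubgraphs.2 ⟨h2, ?_⟩)
        have h3 := G.card_of_spanningConnected h2 v₀
        have σ : {v // v ≠ v₀} ⊕ Fin k ≃ K :=
          (Equiv.ofInjective e hinj).trans (Equiv.setCongr hrange)
        rw [← Fintype.card_coe, ← Fintype.card_congr σ] at h3
        simpa using h3.symm
      have h4 : (M.submatrix e id).det = 0 :=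
        G.det_differentialMatrix_of_not_spanningConnected v₀ θ h1 fun i => by
          have : e i ∈ (K : Set E) := hrange ▸ Set.mem_range_self i
          exact this
      simp [D, dif_neg hK, h4]
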